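/- Let $G$ be a finite multigraph (multiple edges and loops allowed; a loop counts twice toward the degree of its vertex) with vertex set $U$, and let $f:U\to\mathbb{Z}_{\ge 0}$. For a function $g$ on vertices and a set $A$ of vertices put $g(A)=\sum_{v\in A}g(v)$. An $f$-bounded subgraph of $G$ is a spanning subgraph $H$ with $d_H(v)\le f(v)$ for all $v\in U$. For disjoint $S,T\subseteq U$ let $$\mathrm{def}(S,T)=f(T)-f(S)-d_{G-S}(T)+q(S,T),$$ where $d_{G-S}(T)=\sum_{v\in T}d_{G-S}(v)$, and $q(S,T)$ is the number of components of $G-S-T$ whose vertex set $Q$ is such that $f(Q)+\|Q,T\|$ is odd, with $\|Q,T\|$ denoting the number of edges of $G$ joining $Q$ to $T$. Let $h(G;f)$ be the maximum of the degree-sum $d_H(U)$ over all $f$-bounded subgraphs $H$ of $G$. Then $$h(G;f)=\min_{S,T}\bigl[f(U)-\mathrm{def}(S,T)\bigr],$$ where the minimum is over all pairs of disjoint subsets $S,T\subseteq U$. Equivalently, the maximum number of edges in an $f$-bounded subgraph of $G$ is $$\tfrac12\Bigl[f(U)-\max_{S,T}\mathrm{def}(S,T)\Bigr],$$ where the maximum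 is over all pairs of disjoint subsets $S,T\subseteq U$. -/

import Mathlib

namespace Graph

variable {α β : Type*}

/-- `g(A)`: the sum of `g` over the (finite) vertex set `A`. -/
noncomputable def vertexSum (g : α → ℕ) (A : Set α) : ℕ := ∑ᶠ v ∈ A, g v

/-- The degree of `v`: the number of edges at `v`, with loops counted twice. -/
noncomputable def degree (G : Graph α β) (v : α) : ℕ :=
  (G.incidenceSet v).ncard + (G.loopSet v).ncard

/-- `‖A, B‖`: the number of edges with one end in `A` and the other in `B`. -/
noncomputable def numEdgesBetween (G : Graph α β) (A B : Set α) : ℕ :=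
  {e | ∃ x ∈ A, ∃ y ∈ B, G.IsLink e x y}.ncard

/-- The vertex sets of the connected components of `G`. -/
def componentSets (G : Graph α β) : Set (Set α) :=
  {Q | ∃ x ∈ G.vertexSet, Q = {y | Relation.ReflTransGen G.Adj x y}}

/-- `q(S, T)`: the number of components `Q` of `G - S - T` with `f(Q) + ‖Q, T‖` odd. -/
noncomputable def numBad (G : Graph α β) (f : α → ℕ) (S T : Set α) : ℕ :=
  {Q | Q ∈ ((G.deleteVerts S).deleteVerts T).componentSets ∧
    Odd (vertexSum f Q + G.numEdgesBetween Q T)}.ncard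

/-- `def(S, T) = f(T) - f(S) - d_{G-S}(T) + q(S, T)`. -/
noncomputable def deficiency (G : Graph α β) (f : α → ℕ) (S T : Set α) : ℤ :=
  (vertexSum f T : ℤ) - (vertexSum f S : ℤ)
    - (vertexSum (G.deleteVerts S).degree T : ℤ) + (G.numBad f S T : ℤ)

/-- `H` is an `f`-bounded subgraph of `G`: a spanning subgraph with `d_H(v) ≤ f(v)` for every
vertex `v`. -/
def IsBoundedSubgraph (H G : Graph α β) (f : α → ℕ) : Prop :=
  H.IsSpanningSubgraph G ∧ ∀ v ∈ G.vertexSet, H.degree v ≤ f v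

end Graph

/-! Weak duality. Let `H` be `f`-bounded and `S`, `T` disjoint. A component `Q` counted by q(S,T)
contains a vertex below its bound, or sends an edge of `H` to `S`, or sends an edge outside `H` to
`T`: otherwise f(Q) = d_H(Q) would be congruent to ‖Q,T‖ mod 2. Summing these contributions and
comparing degrees at `S` and `T` gives `IsBoundedSubgraph.deficiency_le`.

Attainment. Replace each vertex v by f(v) copies and each edge by two adjacent half-edges, each also
adjacent to all copies of its end. Tutte–Berge gives a matching of this gadget missing at most d
vertices and a barrier X certifying d. The edges with both half-edges matched to copies form an
`f`-bounded `H` with f(U) - 2|E(H)| ≤ d. If X is a smallest optimal barrier, each of its vertices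
has neighbours in three components, so X consists of the copies of a set `S` and the half-edges at a
set `T` (`exists_eq_gadgetSet_of_barrier`). Thus |X| = f(S) + d_G(T). Outside X, the odd components
number at most f(T) + ‖S,T‖ + q(S,T). Hence d ≤ def(S,T), and equality follows. -/

namespace SimpleGraph

/-! ### Components after isolating a vertex set -/

variable {V W : Type*}

/-- The graph obtained from `G` by deleting all edges that meet `X`. -/
def isolate (G : SimpleGraph V) (X : Set V) : SimpleGraph V where
  Adj x y := G.Adj x y ∧ x ∉ X ∧ y ∉ X
  symm := ⟨fun _ _ h => ⟨h.1.symm, h.2.2, h.2.1⟩⟩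
  loopless := ⟨fun _ h => G.loopless.irrefl _ h.1⟩

/-- A vertex set that is closed under adjacency is closed under reachability. -/
lemma Reachable.mem_of_forall_adj {G : SimpleGraph V} {A : Set V}
    (hA : ∀ x ∈ A, ∀ y, G.Adj x y → y ∈ A) {x y : V} (h : G.Reachable x y) (hx : x ∈ A) :
    y ∈ A := by
  obtain ⟨p⟩ := h
  induction p with
  | nil => exact hx
  | cons hadj _ ih => exact ih (hA _ hx _ hadj)

lemma supp_eq_singleton_of_forall_not_adj {G : SimpleGraph V} {x : V}
    (h : ∀ y, ¬ G.Adj x y) : (G.connectedComponentMk x).supp = {x} := by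
  ext y
  simp only [ConnectedComponent.mem_supp_iff, ConnectedComponent.eq, Set.mem_singleton_iff]
  refine ⟨fun hy => ?_, fun hy => hy ▸ Reachable.refl _⟩
  refine hy.symm.mem_of_forall_adj (A := {x}) ?_ rfl
  rintro _ rfl z hz
  exact (h z hz).elim

section ClosedHom

variable {H : SimpleGraph W} {K : SimpleGraph V} (φ : H →g K)

/-- Reachability can be pulled back along a homomorphism whose image is a union of components. -/
lemma Reachable.exists_of_closed_hom
    (hcl : ∀ x y, K.Adj (φ x) y → ∃ x', φ x' = y ∧ H.Adj x x') {x : W} {y : V}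
    (h : K.Reachable (φ x) y) : ∃ x', φ x' = y ∧ H.Reachable x x' := by
  refine h.mem_of_forall_adj (A := {y | ∃ x', φ x' = y ∧ H.Reachable x x'}) ?_
    ⟨x, rfl, Reachable.refl _⟩
  rintro _ ⟨x', rfl, hx'⟩ z hz
  obtain ⟨x'', rfl, hx''⟩ := hcl _ _ hz
  exact ⟨x'', rfl, hx'.trans hx''.reachable⟩

/-- Edges leaving the image lift, so components do not grow under φ. With injectivity, odd
components can then be compared across different vertex types. -/
lemma ConnectedComponent.supp_map_of_closed_hom
    (hcl : ∀ x y, K.Adj (φ x) y → ∃ x', φ x' = y ∧ H.Adj x x') (c : H.ConnectedComponent) :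
    (c.map φ).supp = φ '' c.supp := by
  induction c using ConnectedComponent.ind with | _ x
  ext y
  simp only [ConnectedComponent.map_mk, ConnectedComponent.mem_supp_iff, ConnectedComponent.eq,
    Set.mem_image]
  constructor
  · intro h
    obtain ⟨x', rfl, hx'⟩ := h.symm.exists_of_closed_hom φ hcl
    exact ⟨x', hx'.symm, rfl⟩
  · rintro ⟨x', hx', rfl⟩
    exact hx'.map φ

lemma ConnectedComponent.map_injective_of_closed_hom (hinj : Function.Injective φ)
    (hcl : ∀ x y, K.Adj (φ x) y → ∃ x', φ x' = y ∧ H.Adj x x') :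
    Function.Injective (ConnectedComponent.map φ) := by
  intro c d h
  have := congrArg ConnectedComponent.supp h
  rw [supp_map_of_closed_hom φ hcl, supp_map_of_closed_hom φ hcl] at this
  exact ConnectedComponent.supp_injective (hinj.image_injective this)

lemma ConnectedComponent.odd_map_iff_of_closed_hom (hinj : Function.Injective φ)
    (hcl : ∀ x y, K.Adj (φ x) y → ∃ x', φ x' = y ∧ H.Adj x x') (c : H.ConnectedComponent) :
    c.map φ ∈ K.oddComponents ↔ c ∈ H.oddComponents := by
  simp only [Set.mem_ofPred_eq, supp_map_of_closed_hom φ hcl, Set.ncard_image_of_injective _ hinj]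

end ClosedHom

variable [Finite V] (G : SimpleGraph V)

/-- Isolating instead of deleting keeps the vertex type, but each vertex of `u` becomes an odd
singleton component. This is why later bounds have 2|X| where Tutte's condition has |X|. -/
lemma ncard_oddComponents_deleteVerts_add_le (u : Set V) :
    ((⊤ : G.Subgraph).deleteVerts u).coe.oddComponents.ncard + u.ncard ≤
      (G.isolate u).oddComponents.ncard := by
  classical
  let φ : ((⊤ : G.Subgraph).deleteVerts u).coe →g G.isolate u :=
    ⟨Subtype.val, fun {a b} h => by
      have ha := a.2
      have hb := b.2
      simp only [Subgraph.deleteVerts_verts, Subgraph.verts_top, Set.mem_sdiff] at ha hb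
      exact ⟨Subgraph.Adj.adj_sub (Subgraph.coe_adj _ a b ▸ h), ha.2, hb.2⟩⟩
  have hinj : Function.Injective φ := Subtype.val_injective
  have hcl : ∀ x y, (G.isolate u).Adj (φ x) y →
      ∃ x', φ x' = y ∧ ((⊤ : G.Subgraph).deleteVerts u).coe.Adj x x' := by
    intro x y h
    refine ⟨⟨y, by simpa using h.2.2⟩, rfl, ?_⟩
    have h1 := h.1
    have h2 := h.2
    simp only [Subgraph.coe_adj, Subgraph.deleteVerts_adj, Subgraph.verts_top, Set.mem_univ,
      Subgraph.top_adj, true_and]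
    exact ⟨h2.1, h2.2, h1⟩
  have hmk : Set.InjOn (G.isolate u).connectedComponentMk u := by
    intro x hx y hy hxy
    have h1 : ((G.isolate u).connectedComponentMk x).supp = {x} :=
      supp_eq_singleton_of_forall_not_adj fun z hz => hz.2.1 hx
    have h2 : ((G.isolate u).connectedComponentMk y).supp = {y} :=
      supp_eq_singleton_of_forall_not_adj fun z hz => hz.2.1 hy
    rw [hxy, h2] at h1
    exact (Set.singleton_injective h1).symm
  rw [← Set.ncard_image_of_injective _ (ConnectedComponent.map_injective_of_closed_hom φ hinj hcl),
    ← hmk.ncard_image, ← Set.ncard_union_eq _ (Set.toFinite _) (Set.toFinite _)]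
  · refine Set.ncard_le_ncard ?_ (Set.toFinite _)
    rintro _ (⟨c, hc, rfl⟩ | ⟨x, hx, rfl⟩)
    · exact (ConnectedComponent.odd_map_iff_of_closed_hom φ hinj hcl c).2 hc
    · simp only [Set.mem_ofPred_eq]
      rw [supp_eq_singleton_of_forall_not_adj (G := G.isolate u) fun z hz => hz.2.1 hx]
      simp
  · rw [Set.disjoint_left]
    rintro _ ⟨c, hc, rfl⟩ ⟨x, hx, h⟩
    have : x ∈ (c.map φ).supp := by simp [← h]
    rw [ConnectedComponent.supp_map_of_closed_hom φ hcl] at this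
    obtain ⟨y, -, rfl⟩ := this
    have hy := y.2
    simp only [Subgraph.deleteVerts_verts, Subgraph.verts_top, Set.mem_sdiff] at hy
    exact hy.2 hx

/-! ### The Tutte–Berge formula from Tutte's theorem -/

/-- The join of `G` with a complete graph on `D`. -/
def joinComplete (D : Type*) : SimpleGraph (V ⊕ D) where
  Adj
    | .inl x, .inl y => G.Adj x y
    | a, b => a ≠ b
  symm := ⟨by rintro (x | x) (y | y) h <;> simp_all [G.adj_comm, eq_comm]⟩
  loopless := ⟨by rintro (x | x) h <;> simp_all⟩

/-- If every vertex set `X` satisfies `odd(G - X) ≤ |X| + d` and `d` has the right parity, then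
all vertices of `G` can be matched into each other or into `d` additional points. -/
lemma exists_matching_of_ncard_oddComponents_le (d : ℕ)
    (hd : ∀ X : Set V, (G.isolate X).oddComponents.ncard ≤ 2 * X.ncard + d)
    (hpar : Even (Nat.card V + d)) :
    ∃ m : V → V ⊕ Fin d, Function.Injective m ∧
      ∀ x y, m x = .inl y → G.Adj x y ∧ m y = .inl x := by
  classical
  obtain ⟨M, hM⟩ : ∃ M : (G.joinComplete (Fin d)).Subgraph, M.IsPerfectMatching := by
    rw [tutte]
    intro Y hY
    have h1 := (G.joinComplete (Fin d)).ncard_oddComponents_deleteVerts_add_le Y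
    have h2 : Y.ncard < _ := hY
    -- If an added point lies outside `Y`, all of the complement of `Y` is one component, leaving at
    -- most |Y| + 1 odd components. A Tutte violation needs more than 2|Y|, so there is exactly one,
    -- against parity.
    by_cases hYd : ∃ i : Fin d, .inr i ∉ Y
    · obtain ⟨i, hi⟩ := hYd
      have h3 : ((G.joinComplete (Fin d)).isolate Y).oddComponents ⊆
          ((G.joinComplete (Fin d)).isolate Y).connectedComponentMk '' (insert (.inr i) Y) := by
        intro c _
        induction c using ConnectedComponent.ind with | _ x
        by_cases hx : x ∈ Y
        · exact ⟨x, .inr hx, rfl⟩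
        · refine ⟨.inr i, .inl rfl, ?_⟩
          rw [ConnectedComponent.eq]
          by_cases hxi : x = .inr i
          · rw [hxi]
          · refine Adj.reachable ⟨?_, hi, hx⟩
            cases x <;> simp_all [joinComplete, eq_comm]
      have h4 := (Set.ncard_le_ncard h3 (Set.toFinite _)).trans
        (Set.ncard_image_le (Set.toFinite _))
      have h5 := h4.trans (Set.ncard_insert_le _ _)
      have h6 := ((G.joinComplete (Fin d)).isolate Y).odd_ncard_oddComponents
      have h7 : ((G.joinComplete (Fin d)).isolate Y).oddComponents.ncard = 1 := by omega
      rw [h7, Nat.card_sum, Nat.card_fin] at h6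
      exact Nat.not_odd_iff_even.2 hpar (h6.1 odd_one)
    -- Now `Y` contains all added points. They are isolated and contribute at most d odd components,
    -- while |Y| ≥ |X| + d, so the bound for X excludes a violation.
    · push Not at hYd
      let X : Set V := Sum.inl ⁻¹' Y
      let φ : G.isolate X →g (G.joinComplete (Fin d)).isolate Y :=
        ⟨Sum.inl, fun {a b} h => h⟩
      have hinj : Function.Injective φ := Sum.inl_injective
      have hcl : ∀ x y, ((G.joinComplete (Fin d)).isolate Y).Adj (φ x) y →
          ∃ x', φ x' = y ∧ (G.isolate X).Adj x x' := by
        rintro x (y | i) h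
        · exact ⟨y, rfl, h⟩
        · exact (h.2.2 (hYd i)).elim
      have h3 : ((G.joinComplete (Fin d)).isolate Y).oddComponents ⊆
          ConnectedComponent.map φ '' (G.isolate X).oddComponents ∪
          Set.range fun i : Fin d =>
            ((G.joinComplete (Fin d)).isolate Y).connectedComponentMk (.inr i) := by
        intro c hc
        induction c using ConnectedComponent.ind with | _ x
        rcases x with x | i
        · left
          refine ⟨(G.isolate X).connectedComponentMk x, ?_, rfl⟩
          exact (ConnectedComponent.odd_map_iff_of_closed_hom φ hinj hcl _).1 hc
        · exact .inr ⟨i, rfl⟩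
      have h4 := Set.ncard_le_ncard h3 (Set.toFinite _)
      have h5 := Set.ncard_union_le
        (ConnectedComponent.map φ '' (G.isolate X).oddComponents)
        (Set.range fun i : Fin d =>
            ((G.joinComplete (Fin d)).isolate Y).connectedComponentMk (.inr i))
      have h6 : (ConnectedComponent.map φ '' (G.isolate X).oddComponents).ncard ≤ _ :=
        Set.ncard_image_le (Set.toFinite _)
      have h7 : (Set.range fun i : Fin d =>
          ((G.joinComplete (Fin d)).isolate Y).connectedComponentMk (.inr i)).ncard ≤ d := by
        rw [← Set.image_univ]
        refine (Set.ncard_image_le (Set.toFinite _)).trans ?_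
        simp [Set.ncard_univ]
      have h8 : X.ncard + d ≤ Y.ncard := by
        have : (Sum.inl '' X ∪ Set.range (Sum.inr : Fin d → V ⊕ Fin d)) ⊆ Y := by
          rintro _ (⟨x, hx, rfl⟩ | ⟨i, rfl⟩)
          exacts [hx, hYd i]
        refine le_trans (le_of_eq ?_) (Set.ncard_le_ncard this (Set.toFinite _))
        rw [Set.ncard_union_eq _ (Set.toFinite _) (Set.toFinite _),
          Set.ncard_image_of_injective _ Sum.inl_injective, ← Set.image_univ,
          Set.ncard_image_of_injective _ Sum.inr_injective, Set.ncard_univ, Nat.card_fin]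
        rw [Set.disjoint_left]
        rintro _ ⟨x, hx, rfl⟩ ⟨i, h⟩
        cases h
      have h9 := hd X
      omega
  rw [Subgraph.isPerfectMatching_iff] at hM
  choose g hg hg' using hM
  have hgg : ∀ a, g (g a) = a := fun a => (hg' _ _ (hg a).symm).symm
  refine ⟨fun x => g (.inl x), fun x y h => ?_, fun x y h => ⟨?_, ?_⟩⟩
  · have := congrArg g h
    simpa [hgg] using this
  · have := (hg (.inl x)).adj_sub
    simp only at h
    rw [h] at this
    exact this
  · simp only at h ⊢
    rw [← h, hgg]

/-- Restoring a vertex `x ∈ X` destroys at most the odd components of `G - X` adjacent to `x`. -/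
lemma ncard_oddComponents_isolate_le_of_forall_adj {X : Set V} {x : V} (hx : x ∈ X) (y₁ y₂ : V)
    (h : ∀ y, G.Adj x y → y ∉ X → (G.isolate X).Reachable y₁ y ∨ (G.isolate X).Reachable y₂ y) :
    (G.isolate X).oddComponents.ncard ≤ (G.isolate (X \ {x})).oddComponents.ncard + 2 := by
  classical
  let N : Set (Set V) := {((G.isolate X).connectedComponentMk x).supp,
    ((G.isolate X).connectedComponentMk y₁).supp, ((G.isolate X).connectedComponentMk y₂).supp}
  have hN : N.ncard ≤ 3 := by
    refine (Set.ncard_insert_le _ _).trans ?_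
    have := Set.ncard_insert_le ((G.isolate X).connectedComponentMk y₁).supp
      {((G.isolate X).connectedComponentMk y₂).supp}
    rw [Set.ncard_singleton] at this
    omega
  have hsub : ConnectedComponent.supp '' (G.isolate X).oddComponents ⊆
      ConnectedComponent.supp '' (G.isolate (X \ {x})).oddComponents ∪ N := by
    rintro _ ⟨c, hc, rfl⟩
    by_cases hcN : c.supp ∈ N
    · exact .inr hcN
    left
    induction c using ConnectedComponent.ind with | _ z
    have hzx : ¬ (G.isolate X).Reachable z x := fun hr => hcN (by
      rw [ConnectedComponent.eq.2 hr]; simp [N])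
    have hz1 : ¬ (G.isolate X).Reachable z y₁ := fun hr => hcN (by
      rw [ConnectedComponent.eq.2 hr]; simp [N])
    have hz2 : ¬ (G.isolate X).Reachable z y₂ := fun hr => hcN (by
      rw [ConnectedComponent.eq.2 hr]; simp [N])
    have hle : G.isolate X ≤ G.isolate (X \ {x}) := fun a b hab =>
      ⟨hab.1, fun h => hab.2.1 h.1, fun h => hab.2.2 h.1⟩
    have hsupp : ((G.isolate (X \ {x})).connectedComponentMk z).supp =
        ((G.isolate X).connectedComponentMk z).supp := by
      ext w
      simp only [ConnectedComponent.mem_supp_iff, ConnectedComponent.eq]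
      refine ⟨fun hw => ?_, fun hw => hw.mono hle⟩
      refine Reachable.symm (hw.symm.mem_of_forall_adj
        (A := {w | (G.isolate X).Reachable z w}) ?_ (Reachable.refl _))
      intro a ha b hab
      have hax : a ≠ x := by rintro rfl; exact hzx ha
      have haX : a ∉ X := fun h => hab.2.1 ⟨h, hax⟩
      have hbx : b ≠ x := by
        rintro rfl
        rcases h a hab.1.symm haX with h1 | h2
        · exact hz1 (ha.trans h1.symm)
        · exact hz2 (ha.trans h2.symm)
      exact ha.trans (Adj.reachable ⟨hab.1, haX, fun h => hab.2.2 ⟨h, hbx⟩⟩)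
    refine ⟨(G.isolate (X \ {x})).connectedComponentMk z, ?_, hsupp⟩
    simp only [Set.mem_ofPred_eq, hsupp]
    exact hc
  have h1 := (Set.ncard_le_ncard hsub (Set.toFinite _)).trans (Set.ncard_union_le _ _)
  rw [Set.ncard_image_of_injective _ ConnectedComponent.supp_injective,
    Set.ncard_image_of_injective _ ConnectedComponent.supp_injective] at h1
  -- So far at most three odd components are lost. Both counts have the parity of |V|, so the loss
  -- is at most two.
  have h2 := (G.isolate X).odd_ncard_oddComponents
  have h3 := (G.isolate (X \ {x})).odd_ncard_oddComponents
  rw [← h3] at h2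
  simp only [Nat.odd_iff] at h2
  omega

/-- The Tutte–Berge formula, with a barrier `X` such that each of its vertices has neighbours in at
least three components of `G - X`. -/
theorem exists_barrier_and_matching :
    ∃ (X : Set V) (d : ℕ), (G.isolate X).oddComponents.ncard = 2 * X.ncard + d ∧
      (∀ x ∈ X, ∀ y₁ y₂, ∃ y, G.Adj x y ∧ y ∉ X ∧
        ¬ (G.isolate X).Reachable y₁ y ∧ ¬ (G.isolate X).Reachable y₂ y) ∧
      ∃ m : V → V ⊕ Fin d, Function.Injective m ∧
        ∀ x y, m x = .inl y → G.Adj x y ∧ m y = .inl x := by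
  classical
  let δ : Set V → ℤ := fun X => ((G.isolate X).oddComponents.ncard : ℤ) - 2 * X.ncard
  obtain ⟨X₀, hX₀⟩ := Finite.exists_max δ
  -- A smallest maximizer of δ: removing any vertex from it must lower δ.
  obtain ⟨X, hX, hmin⟩ := Set.exists_min_image {X | δ X = δ X₀} Set.ncard (Set.toFinite _)
    ⟨X₀, rfl⟩
  have hmax : ∀ Y, δ Y ≤ δ X := fun Y => (hX₀ Y).trans_eq hX.symm
  have h0 : 0 ≤ δ X := le_trans (by simp [δ]) (hmax ∅)
  have hd : (G.isolate X).oddComponents.ncard = 2 * X.ncard + (δ X).toNat := by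
    have : ((δ X).toNat : ℤ) = δ X := Int.toNat_of_nonneg h0
    simp only [δ] at this ⊢
    omega
  refine ⟨X, (δ X).toNat, hd, ?_, ?_⟩
  · intro x hx y₁ y₂
    by_contra! hcon
    have h1 := G.ncard_oddComponents_isolate_le_of_forall_adj hx y₁ y₂ fun y hy hyX => by
      by_contra! h
      exact h.2 (hcon y hy hyX h.1)
    have h2 := Set.ncard_sdiff_singleton_add_one hx (Set.toFinite _)
    have h3 := hmax (X \ {x})
    -- The odd count drops by at most 2 and 2|X| by exactly 2, so δ does not decrease.
    have h4 : δ (X \ {x}) = δ X₀ := by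
      rw [← show δ X = δ X₀ from hX]
      refine le_antisymm h3 ?_
      simp only [δ]
      omega
    have := hmin _ h4
    omega
  · refine G.exists_matching_of_ncard_oddComponents_le _ (fun Y => ?_) ?_
    · have := hmax Y
      simp only [δ] at this ⊢
      omega
    · have h2 := (G.isolate X).odd_ncard_oddComponents
      simp only [Nat.odd_iff, Nat.even_iff] at *
      omega

end SimpleGraph

namespace Graph

open scoped Classical

variable {α β : Type*}

/-! ### Degrees and edge counts as sums over edges with chosen ends -/

lemma vertexSum_eq_sum {g : α → ℕ} {A : Set α} {W : Finset α} (hA : A ⊆ W) :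
    vertexSum g A = ∑ v ∈ W, if v ∈ A then g v else 0 := by
  rw [vertexSum, ← Finset.sum_filter, ← finsum_mem_coe_finset]
  have : (↑{v ∈ W | v ∈ A} : Set α) = A := by
    ext v
    simpa using fun h => hA h
  rw [this]

/-- `ends` assigns to every edge in `F = E(G)` its two ends. -/
structure IsEnds (G : Graph α β) (F : Finset β) (ends : β → Bool → α) : Prop where
  edgeSet_eq : G.edgeSet = F
  isLink : ∀ e ∈ F, G.IsLink e (ends e false) (ends e true)

lemma exists_isEnds [Nonempty α] (G : Graph α β) (hE : G.edgeSet.Finite) :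
    ∃ F ends, G.IsEnds F ends := by
  have : ∀ e, ∃ p : Bool → α, e ∈ G.edgeSet → G.IsLink e (p false) (p true) := by
    intro e
    by_cases he : e ∈ G.edgeSet
    · obtain ⟨x, y, h⟩ := G.exists_isLink_of_mem_edgeSet he
      exact ⟨fun b => if b then y else x, fun _ => by simpa using h⟩
    · exact ⟨fun _ => Classical.arbitrary α, fun h => (he h).elim⟩
  choose p hp using this
  exact ⟨hE.toFinset, p, by simp, fun e he => hp e (by simpa using he)⟩

namespace IsEnds

variable {G : Graph α β} {F : Finset β} {ends : β → Bool → α}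

lemma isLink_iff (h : G.IsEnds F ends) {e : β} {x y : α} :
    G.IsLink e x y ↔ e ∈ F ∧ ((ends e false = x ∧ ends e true = y) ∨
      (ends e false = y ∧ ends e true = x)) := by
  constructor
  · intro hl
    have he : e ∈ F := by simpa [h.edgeSet_eq] using hl.edge_mem
    exact ⟨he, (h.isLink e he).isLink_iff.1 hl |>.imp (fun h => ⟨h.1, h.2⟩) fun h => ⟨h.1, h.2⟩⟩
  · rintro ⟨he, ⟨rfl, rfl⟩ | ⟨rfl, rfl⟩⟩
    exacts [h.isLink e he, (h.isLink e he).symm]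

lemma isLink_not (h : G.IsEnds F ends) {e : β} (he : e ∈ F) (b : Bool) :
    G.IsLink e (ends e b) (ends e !b) := by
  cases b
  exacts [h.isLink e he, (h.isLink e he).symm]

lemma ends_mem (h : G.IsEnds F ends) {e : β} (he : e ∈ F) (b : Bool) :
    ends e b ∈ G.vertexSet := (h.isLink_not he b).left_mem

lemma degree_eq (h : G.IsEnds F ends) (v : α) :
    G.degree v = ∑ e ∈ F, ((if ends e false = v then 1 else 0) +
      (if ends e true = v then 1 else 0)) := by
  have h1 : G.incidenceSet v = ↑{e ∈ F | ends e false = v ∨ ends e true = v} := by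
    ext e
    simp only [mem_incidenceSet, Inc, h.isLink_iff, Finset.coe_filter, Set.mem_ofPred_eq]
    constructor
    · rintro ⟨y, he, h | h⟩ <;> simp [he, h]
    · rintro ⟨he, h | h⟩
      · exact ⟨_, he, .inl ⟨h, rfl⟩⟩
      · exact ⟨_, he, .inr ⟨rfl, h⟩⟩
  have h2 : G.loopSet v = ↑{e ∈ F | ends e false = v ∧ ends e true = v} := by
    ext e
    simp [mem_loopSet, ← isLink_self_iff, h.isLink_iff]
  rw [degree, h1, h2, Set.ncard_coe_finset, Set.ncard_coe_finset, Finset.card_filter,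
    Finset.card_filter, ← Finset.sum_add_distrib]
  refine Finset.sum_congr rfl fun e _ => ?_
  by_cases h1 : ends e false = v <;> by_cases h2 : ends e true = v <;> simp [h1, h2]

lemma vertexSum_degree (h : G.IsEnds F ends) {A : Set α} (hA : A.Finite) :
    vertexSum G.degree A = ∑ e ∈ F, ((if ends e false ∈ A then 1 else 0) +
      (if ends e true ∈ A then 1 else 0)) := by
  rw [vertexSum, finsum_mem_eq_finite_toFinset_sum _ hA]
  simp_rw [h.degree_eq]
  rw [Finset.sum_comm]
  refine Finset.sum_congr rfl fun e _ => ?_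
  rw [Finset.sum_add_distrib]
  simp

lemma numEdgesBetween_eq (h : G.IsEnds F ends) (A B : Set α) :
    G.numEdgesBetween A B = ∑ e ∈ F, if (ends e false ∈ A ∧ ends e true ∈ B) ∨
      (ends e false ∈ B ∧ ends e true ∈ A) then 1 else 0 := by
  rw [numEdgesBetween, ← Finset.card_filter, ← Set.ncard_coe_finset]
  congr 1
  ext e
  simp only [h.isLink_iff, Finset.coe_filter, Set.mem_ofPred_eq]
  constructor
  · rintro ⟨x, hx, y, hy, he, ⟨rfl, rfl⟩ | ⟨rfl, rfl⟩⟩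
    exacts [⟨he, .inl ⟨hx, hy⟩⟩, ⟨he, .inr ⟨hy, hx⟩⟩]
  · rintro ⟨he, ⟨h1, h2⟩ | ⟨h1, h2⟩⟩
    exacts [⟨_, h1, _, h2, he, .inl ⟨rfl, rfl⟩⟩, ⟨_, h2, _, h1, he, .inr ⟨rfl, rfl⟩⟩]

lemma of_le (h : G.IsEnds F ends) {H : Graph α β} (hH : H ≤ G) :
    H.IsEnds {e ∈ F | e ∈ H.edgeSet} ends where
  edgeSet_eq := by
    ext e
    have : e ∈ H.edgeSet → e ∈ G.edgeSet := fun he => hH.edgeSet_mono he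
    simp_all [h.edgeSet_eq]
  isLink e he := by
    simp only [Finset.mem_filter] at he
    exact (hH.isLink_iff he.2).2 (h.isLink e he.1)

lemma deleteVerts (h : G.IsEnds F ends) (S : Set α) :
    (G.deleteVerts S).IsEnds {e ∈ F | ends e false ∉ S ∧ ends e true ∉ S} ends where
  edgeSet_eq := by
    ext e
    simp only [edgeSet_deleteVerts, Set.mem_ofPred_eq, h.isLink_iff, Finset.coe_filter]
    constructor
    · rintro ⟨x, y, ⟨he, ⟨rfl, rfl⟩ | ⟨rfl, rfl⟩⟩, h1, h2⟩
      exacts [⟨he, h1, h2⟩, ⟨he, h2, h1⟩]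
    · rintro ⟨he, h1, h2⟩
      exact ⟨_, _, ⟨he, .inl ⟨rfl, rfl⟩⟩, h1, h2⟩
  isLink e he := by
    simp only [Finset.mem_filter] at he
    exact (deleteVerts_isLink ..).2 ⟨h.isLink e he.1, he.2⟩

/-- The degree sum is twice the number of edges. -/
lemma vertexSum_degree_vertexSet (h : G.IsEnds F ends) (hV : G.vertexSet.Finite) :
    vertexSum G.degree G.vertexSet = 2 * F.card := by
  rw [h.vertexSum_degree hV, Finset.sum_congr rfl fun e he => by
    rw [if_pos (h.ends_mem he false), if_pos (h.ends_mem he true)]]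
  simp [mul_comm]

end IsEnds

/-! ### Components of G - S - T -/

section Components

variable {G : Graph α β} {Q Q' : Set α}

lemma reflTransGen_adj_symm {x y : α} (h : Relation.ReflTransGen G.Adj x y) :
    Relation.ReflTransGen G.Adj y x := by
  induction h with
  | refl => exact .refl
  | tail _ h ih => exact .head h.symm ih

lemma subset_vertexSet_of_mem_componentSets (hQ : Q ∈ G.componentSets) : Q ⊆ G.vertexSet := by
  obtain ⟨x, hx, rfl⟩ := hQ
  intro y hy
  cases hy with
  | refl => exact hx
  | tail _ h => exact h.right_mem

lemma mem_of_adj_of_mem_componentSets (hQ : Q ∈ G.componentSets) {x y : α} (hx : x ∈ Q)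
    (h : G.Adj x y) : y ∈ Q := by
  obtain ⟨z, hz, rfl⟩ := hQ
  exact hx.tail h

lemma eq_of_mem_componentSets (hQ : Q ∈ G.componentSets) (hQ' : Q' ∈ G.componentSets) {x : α}
    (hx : x ∈ Q) (hx' : x ∈ Q') : Q = Q' := by
  obtain ⟨z, hz, rfl⟩ := hQ
  obtain ⟨z', hz', rfl⟩ := hQ'
  ext y
  exact ⟨fun hy => (hx'.trans (reflTransGen_adj_symm hx)).trans hy,
    fun hy => (hx.trans (reflTransGen_adj_symm hx')).trans hy⟩

variable {S T : Set α}

lemma subset_of_mem_componentSets_deleteVerts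
    (hQ : Q ∈ ((G.deleteVerts S).deleteVerts T).componentSets) : Q ⊆ (G.vertexSet \ S) \ T := by
  simpa using subset_vertexSet_of_mem_componentSets hQ

lemma mem_of_isLink_of_mem_componentSets_deleteVerts
    (hQ : Q ∈ ((G.deleteVerts S).deleteVerts T).componentSets) {e : β} {x y : α}
    (h : G.IsLink e x y) (hx : x ∈ Q) (hyS : y ∉ S) (hyT : y ∉ T) : y ∈ Q := by
  have hx' := subset_of_mem_componentSets_deleteVerts hQ hx
  refine mem_of_adj_of_mem_componentSets hQ hx ⟨e, ?_⟩
  simp only [deleteVerts_isLink]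
  exact ⟨⟨h, hx'.1.2, hyS⟩, hx'.2, hyT⟩

lemma finite_componentSets_deleteVerts (hV : G.vertexSet.Finite) :
    ((G.deleteVerts S).deleteVerts T).componentSets.Finite :=
  hV.finite_subsets.subset fun _ hQ =>
    (subset_of_mem_componentSets_deleteVerts hQ).trans (Set.sdiff_subset.trans Set.sdiff_subset)

end Components

/-- If at most one member of `s` satisfies `p`, and only if `r` holds, then the number of members
satisfying `p` is at most the indicator of `r`. -/
lemma sum_ite_le_ite {ι : Type*} (s : Finset ι) (p : ι → Prop) (r : Prop)
    [DecidablePred p] [Decidable r]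
    (huniq : ∀ i ∈ s, ∀ j ∈ s, p i → p j → i = j) (hr : ∀ i ∈ s, p i → r) :
    (∑ i ∈ s, if p i then 1 else 0) ≤ if r then 1 else 0 := by
  rw [← Finset.card_filter]
  by_cases h : r
  · rw [if_pos h, Finset.card_le_one]
    simp only [Finset.mem_filter]
    exact fun i hi j hj => huniq i hi.1 j hj.1 hi.2 hj.2
  · rw [if_neg h, Nat.le_zero, Finset.card_eq_zero, Finset.filter_eq_empty_iff]
    exact fun i hi hp => h (hr i hi hp)

/-! ### Weak duality -/

section UpperBound

variable {G H : Graph α β} {f : α → ℕ} {F : Finset β} {ends : β → Bool → α} {S T Q : Set α}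

/-- In a component `Q` of `G - S - T` with `f(Q) + ‖Q, T‖` odd, either some vertex does not attain
its bound, or some edge of `H` joins `Q` to `S`, or some edge outside `H` joins `Q` to `T`. -/
lemma IsBoundedSubgraph.one_le_of_odd (hE : G.IsEnds F ends) {W : Finset α}
    (hV : G.vertexSet = W) (hH : H.IsBoundedSubgraph G f)
    (hQ : Q ∈ ((G.deleteVerts S).deleteVerts T).componentSets)
    (hodd : Odd (vertexSum f Q + G.numEdgesBetween Q T)) :
    1 ≤ (∑ v ∈ W, if v ∈ Q then f v - H.degree v else 0) +
      ∑ e ∈ F, ((if e ∈ H.edgeSet ∧ ((ends e false ∈ Q ∧ ends e true ∈ S) ∨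
          (ends e false ∈ S ∧ ends e true ∈ Q)) then 1 else 0) +
        (if e ∉ H.edgeSet ∧ ((ends e false ∈ Q ∧ ends e true ∈ T) ∨
          (ends e false ∈ T ∧ ends e true ∈ Q)) then 1 else 0)) := by
  by_contra hlt
  rw [Nat.not_le, Nat.lt_one_iff, Nat.add_eq_zero_iff, Finset.sum_eq_zero_iff,
    Finset.sum_eq_zero_iff] at hlt
  obtain ⟨h1, h2⟩ := hlt
  have hQsub := subset_of_mem_componentSets_deleteVerts hQ
  have hQV : Q ⊆ W := fun v hv => hV ▸ (hQsub hv).1.1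
  have hf : vertexSum f Q = vertexSum H.degree Q := by
    rw [vertexSum_eq_sum hQV, vertexSum_eq_sum hQV]
    refine Finset.sum_congr rfl fun v hv => ?_
    by_cases hvQ : v ∈ Q
    · have h3 := h1 v hv
      have h4 := hH.2 v (hV ▸ hv)
      simp only [hvQ, if_true] at h3 ⊢
      omega
    · simp [hvQ]
  have hHE := hE.of_le hH.1.le
  rw [hf, hHE.vertexSum_degree (W.finite_toSet.subset hQV), hE.numEdgesBetween_eq,
    Finset.sum_filter, ← Finset.sum_add_distrib, ← Nat.not_even_iff_odd] at hodd
  -- Each edge contributes evenly: an edge of `H` inside `Q` counts twice in the degree sum, and a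
  -- `Q`–`T` edge, being in `H`, counts once there and once in ‖Q,T‖.
  refine hodd (Finset.even_sum _ fun e he => ?_)
  have h3 := h2 e he
  have hl := hE.isLink e he
  have ha := @hQsub (ends e false)
  have hb := @hQsub (ends e true)
  have hc1 := mem_of_isLink_of_mem_componentSets_deleteVerts hQ hl
  have hc2 := mem_of_isLink_of_mem_componentSets_deleteVerts hQ hl.symm
  simp only [Set.mem_sdiff] at ha hb
  by_cases heH : e ∈ H.edgeSet <;> by_cases h4 : ends e false ∈ Q <;>
    by_cases h5 : ends e true ∈ Q <;> by_cases h6 : ends e false ∈ T <;>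
    by_cases h7 : ends e true ∈ T <;> simp_all

lemma IsBoundedSubgraph.deficiency_le (hE : G.IsEnds F ends) (hV : G.vertexSet.Finite)
    (hH : H.IsBoundedSubgraph G f) (hS : S ⊆ G.vertexSet) (hT : T ⊆ G.vertexSet)
    (hST : Disjoint S T) :
    G.deficiency f S T ≤ (vertexSum f G.vertexSet : ℤ) - vertexSum H.degree G.vertexSet := by
  obtain ⟨W, hW⟩ := hV.exists_finset_coe
  have hW : G.vertexSet = W := hW.symm
  have hbad := (finite_componentSets_deleteVerts (S := S) (T := T) hV).subset
    (Set.sep_subset _ fun Q => Odd (vertexSum f Q + G.numEdgesBetween Q T))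
  obtain ⟨B, hB⟩ := hbad.exists_finset_coe
  have hBmem : ∀ Q ∈ B, Q ∈ ((G.deleteVerts S).deleteVerts T).componentSets ∧
      Odd (vertexSum f Q + G.numEdgesBetween Q T) := by
    intro Q hQ
    have : Q ∈ (B : Set (Set α)) := hQ
    rwa [hB] at this
  have hq : G.numBad f S T = B.card := by
    rw [← Set.ncard_coe_finset, hB]; rfl
  have hsub : ∀ Q ∈ B, ∀ v ∈ Q, v ∈ G.vertexSet ∧ v ∉ S ∧ v ∉ T := fun Q hQ v hv => by
    have := subset_of_mem_componentSets_deleteVerts (hBmem Q hQ).1 hv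
    exact ⟨this.1.1, this.1.2, this.2⟩
  have huniq : ∀ Q ∈ B, ∀ Q' ∈ B, ∀ v, v ∈ Q → v ∈ Q' → Q = Q' := fun Q hQ Q' hQ' v h h' =>
    eq_of_mem_componentSets (hBmem Q hQ).1 (hBmem Q' hQ').1 h h'
  have hdis : ∀ v ∈ S, v ∉ T := fun v h h' => Set.disjoint_left.1 hST h h'
  -- Components are disjoint, so each vertex or edge is charged by at most one of them.
  have key : B.card ≤ (∑ v ∈ W, if v ∉ S ∧ v ∉ T then f v - H.degree v else 0) +
      ∑ e ∈ F, ((if e ∈ H.edgeSet ∧ ((ends e false ∉ S ∧ ends e false ∉ T ∧ ends e true ∈ S) ∨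
          (ends e false ∈ S ∧ ends e true ∉ S ∧ ends e true ∉ T)) then 1 else 0) +
        (if e ∉ H.edgeSet ∧ ((ends e false ∉ S ∧ ends e false ∉ T ∧ ends e true ∈ T) ∨
          (ends e false ∈ T ∧ ends e true ∉ S ∧ ends e true ∉ T)) then 1 else 0)) := by
    have h1 : B.card ≤ _ := (Finset.card_eq_sum_ones B).le.trans (Finset.sum_le_sum fun Q hQ =>
      hH.one_le_of_odd hE hW (hBmem Q hQ).1 (hBmem Q hQ).2)
    refine h1.trans ?_
    rw [Finset.sum_add_distrib, Finset.sum_comm, Finset.sum_comm (s := B)]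
    refine add_le_add (Finset.sum_le_sum fun v _ => ?_) (Finset.sum_le_sum fun e _ => ?_)
    · have h2 := sum_ite_le_ite B (fun Q => v ∈ Q) (v ∉ S ∧ v ∉ T)
        (fun Q hQ Q' hQ' => huniq Q hQ Q' hQ' v) fun Q hQ hv => (hsub Q hQ v hv).2
      have h3 := Nat.mul_le_mul_right (f v - H.degree v) h2
      simpa only [Finset.sum_mul, ite_mul, one_mul, zero_mul] using h3
    · rw [Finset.sum_add_distrib]
      refine add_le_add (sum_ite_le_ite B _ _ ?_ ?_) (sum_ite_le_ite B _ _ ?_ ?_)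
      · rintro Q hQ Q' hQ' ⟨-, h | h⟩ ⟨-, h' | h'⟩
        · exact huniq Q hQ Q' hQ' _ h.1 h'.1
        · exact ((hsub Q hQ _ h.1).2.1 h'.1).elim
        · exact ((hsub Q hQ _ h.2).2.1 h'.2).elim
        · exact huniq Q hQ Q' hQ' _ h.2 h'.2
      · rintro Q hQ ⟨h, h1 | h1⟩
        · exact ⟨h, .inl ⟨(hsub Q hQ _ h1.1).2.1, (hsub Q hQ _ h1.1).2.2, h1.2⟩⟩
        · exact ⟨h, .inr ⟨h1.1, (hsub Q hQ _ h1.2).2⟩⟩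
      · rintro Q hQ Q' hQ' ⟨-, h | h⟩ ⟨-, h' | h'⟩
        · exact huniq Q hQ Q' hQ' _ h.1 h'.1
        · exact ((hsub Q hQ _ h.1).2.2 h'.1).elim
        · exact ((hsub Q hQ _ h.2).2.2 h'.2).elim
        · exact huniq Q hQ Q' hQ' _ h.2 h'.2
      · rintro Q hQ ⟨h, h1 | h1⟩
        · exact ⟨h, .inl ⟨(hsub Q hQ _ h1.1).2.1, (hsub Q hQ _ h1.1).2.2, h1.2⟩⟩
        · exact ⟨h, .inr ⟨h1.1, (hsub Q hQ _ h1.2).2⟩⟩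
  have hHE := hE.of_le hH.1.le
  have hdS : vertexSum H.degree S ≤ vertexSum f S := by
    rw [vertexSum_eq_sum (hW ▸ hS), vertexSum_eq_sum (hW ▸ hS)]
    refine Finset.sum_le_sum fun v hv => ?_
    have := hH.2 v (hW ▸ hv)
    split_ifs <;> simp [this]
  -- Edges of `H` from `S` to `T` or to the rest are paid for by d_H(S). Edges at `T` avoiding `S`,
  -- in `H` or not, are paid for by d_{G-S}(T).
  have hedge : (∑ e ∈ F, ((if e ∈ H.edgeSet ∧ ((ends e false ∉ S ∧ ends e false ∉ T ∧
          ends e true ∈ S) ∨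
          (ends e false ∈ S ∧ ends e true ∉ S ∧ ends e true ∉ T)) then 1 else 0) +
        (if e ∉ H.edgeSet ∧ ((ends e false ∉ S ∧ ends e false ∉ T ∧ ends e true ∈ T) ∨
          (ends e false ∈ T ∧ ends e true ∉ S ∧ ends e true ∉ T)) then 1 else 0))) +
      vertexSum H.degree T ≤ vertexSum H.degree S + vertexSum (G.deleteVerts S).degree T := by
    rw [hHE.vertexSum_degree (hV.subset hS), hHE.vertexSum_degree (hV.subset hT),
      (hE.deleteVerts S).vertexSum_degree (hV.subset hT), Finset.sum_filter, Finset.sum_filter,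
      Finset.sum_filter, ← Finset.sum_add_distrib, ← Finset.sum_add_distrib]
    refine Finset.sum_le_sum fun e _ => ?_
    have ha := hdis (ends e false)
    have hb := hdis (ends e true)
    by_cases heH : e ∈ H.edgeSet <;> by_cases h4 : ends e false ∈ S <;>
      by_cases h5 : ends e true ∈ S <;> by_cases h6 : ends e false ∈ T <;>
      by_cases h7 : ends e true ∈ T <;>
      first
        | exact absurd h6 (ha h4)
        | exact absurd h7 (hb h5)
        | simp [heH, h4, h5, h6, h7]
  have hvert : (∑ v ∈ W, if v ∉ S ∧ v ∉ T then f v - H.degree v else 0) +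
      vertexSum f S + vertexSum f T + vertexSum H.degree G.vertexSet =
      vertexSum f G.vertexSet + vertexSum H.degree S + vertexSum H.degree T := by
    rw [vertexSum_eq_sum (hW ▸ hS), vertexSum_eq_sum (hW ▸ hT), vertexSum_eq_sum hW.subset,
      vertexSum_eq_sum (g := H.degree) (hW ▸ hS), vertexSum_eq_sum (g := H.degree) (hW ▸ hT),
      vertexSum_eq_sum hW.subset]
    simp only [← Finset.sum_add_distrib]
    refine Finset.sum_congr rfl fun v hv => ?_
    have hvV : v ∈ G.vertexSet := hW ▸ hv
    have h1 := hH.2 v hvV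
    have h2 := hdis v
    by_cases h4 : v ∈ S <;> by_cases h5 : v ∈ T
    · exact absurd h5 (h2 h4)
    all_goals simp only [h4, h5, hvV, not_true_eq_false, not_false_eq_true, and_self, and_true,
      and_false, if_true, if_false]; omega
  rw [deficiency, hq]
  omega

end UpperBound

/-! ### The gadget reducing bounded subgraphs to matchings -/

/-- The vertices of the gadget graph: `f v` copies of each vertex `v ∈ W` and two half-edges for
each edge `e ∈ F`. -/
abbrev GadgetVertex (W : Finset α) (F : Finset β) (f : α → ℕ) : Type _ :=
  (Σ v : W, Fin (f v)) ⊕ (F × Bool)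

variable {W : Finset α} {F : Finset β} {f : α → ℕ}

/-- The gadget graph, in which a half-edge is adjacent to the opposite half-edge and to all copies
of its end. -/
def gadget (W : Finset α) (F : Finset β) (f : α → ℕ) (ends : β → Bool → α) :
    SimpleGraph (GadgetVertex W F f) where
  Adj
    | .inl _, .inl _ => False
    | .inl p, .inr h => ends h.1 h.2 = p.1
    | .inr h, .inl p => ends h.1 h.2 = p.1
    | .inr h, .inr h' => h.1 = h'.1 ∧ h.2 ≠ h'.2
  symm := ⟨by rintro (x | x) (y | y) h <;> simp_all [eq_comm]⟩
  loopless := ⟨by rintro (x | x) h <;> simp_all⟩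

/-- The copies of the vertices in `A` together with the half-edges satisfying `R`. -/
def gadgetSet (W : Finset α) (F : Finset β) (f : α → ℕ) (A : Set α) (R : β → Bool → Prop) :
    Set (GadgetVertex W F f) :=
  {z | Sum.elim (fun p : Σ v : W, Fin (f v) => (p.1 : α) ∈ A)
    (fun h : F × Bool => R h.1 h.2) z}

@[simp]
lemma inl_mem_gadgetSet {A : Set α} {R : β → Bool → Prop} {p : Σ v : W, Fin (f v)} :
    .inl p ∈ gadgetSet W F f A R ↔ (p.1 : α) ∈ A := Iff.rfl

@[simp]
lemma inr_mem_gadgetSet {A : Set α} {R : β → Bool → Prop} {h : F × Bool} :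
    .inr h ∈ gadgetSet W F f A R ↔ R h.1 h.2 := Iff.rfl

lemma ncard_gadgetSet (A : Set α) (R : β → Bool → Prop) [∀ e b, Decidable (R e b)] :
    (gadgetSet W F f A R).ncard = (∑ v ∈ W, if v ∈ A then f v else 0) +
      ∑ e ∈ F, ((if R e false then 1 else 0) + (if R e true then 1 else 0)) := by
  have h1 : (gadgetSet W F f A R).ncard =
      ∑ z : GadgetVertex W F f, if z ∈ gadgetSet W F f A R then 1 else 0 := by
    rw [← Finset.card_filter, ← Set.ncard_coe_finset]
    simp
  rw [h1, Fintype.sum_sum_type, Fintype.sum_sigma, Fintype.sum_prod_type]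
  simp only [inl_mem_gadgetSet, inr_mem_gadgetSet, Finset.sum_const, Finset.card_univ,
    Fintype.card_fin, Fintype.sum_bool, smul_eq_mul, mul_ite, mul_one, mul_zero]
  rw [← Finset.sum_coe_sort W, ← Finset.sum_coe_sort F]
  simp only [add_comm]

/-! ### Structure of the barrier -/

section Barrier

variable {ends : β → Bool → α} {X : Set (GadgetVertex W F f)}

/-- A barrier of the gadget each of whose vertices has neighbours in at least three components
comes from a pair of disjoint vertex sets. -/
lemma exists_eq_gadgetSet_of_barrier (hends : ∀ e ∈ F, ∀ b, ends e b ∈ W)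
    (hX : ∀ x ∈ X, ∀ y₁ y₂, ∃ y, (gadget W F f ends).Adj x y ∧ y ∉ X ∧
      ¬ ((gadget W F f ends).isolate X).Reachable y₁ y ∧
      ¬ ((gadget W F f ends).isolate X).Reachable y₂ y) :
    ∃ S T : Set α, S ⊆ W ∧ T ⊆ W ∧ Disjoint S T ∧
      X = gadgetSet W F f S (fun e b => ends e b ∈ T) ∧
      (∀ v ∈ W, v ∉ S → 0 < f v) ∧
      (∀ v ∈ W, v ∉ S → v ∉ T → ∃ e ∈ F, ∃ b, ends e b = v) := by
  -- Vertices with f(v) = 0 fall into `S` vacuously, and vertices outside `S` without edges fall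
  -- into `T`; this yields the last two conclusions.
  let S : Set α := {v | ∃ hv : v ∈ W, ∀ i : Fin (f v), .inl ⟨⟨v, hv⟩, i⟩ ∈ X}
  let T : Set α := {v | v ∈ W ∧ v ∉ S ∧ ∀ h : F × Bool, ends h.1 h.2 = v → .inr h ∈ X}
  have hcopy : ∀ p : Σ v : W, Fin (f v), .inl p ∈ X → (p.1 : α) ∈ S := by
    rintro ⟨⟨v, hv⟩, i⟩ hp
    refine ⟨hv, fun j => ?_⟩
    by_contra hj
    -- Copies of v have the same neighbours, so a copy outside X puts all those outside X into its
    -- own component.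
    obtain ⟨y, hy, hyX, hr, -⟩ := hX _ hp (.inl ⟨⟨v, hv⟩, j⟩) (.inl ⟨⟨v, hv⟩, j⟩)
    rcases y with y | y
    · exact hy
    · exact hr (SimpleGraph.Adj.reachable ⟨hy, hj, hyX⟩)
  have hhalf : ∀ h : F × Bool, .inr h ∈ X → ends h.1 h.2 ∈ T := by
    intro h hh
    refine ⟨hends _ h.1.2 _, ?_, ?_⟩
    · rintro ⟨hv, hS⟩
      -- With all copies of the end in X, only the opposite half-edge remains as a neighbour.
      obtain ⟨y, hy, hyX, hr, -⟩ := hX _ hh (.inr (h.1, !h.2)) (.inr (h.1, !h.2))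
      rcases y with ⟨⟨v, hv'⟩, i⟩ | ⟨e, b⟩
      · have hy : ends h.1 h.2 = v := hy
        subst hy
        exact hyX (hS i)
      · have h1 : h.1 = e := hy.1
        have h2 : h.2 ≠ b := hy.2
        have h3 : (!h.2) = b := Bool.not_eq.2 h2
        rw [h1, h3] at hr
        exact hr (SimpleGraph.Reachable.refl _)
    · intro h' hh'
      by_contra hX'
      -- A half-edge `h'` at the same end outside X gathers the copies outside X into one component;
      -- with the opposite half-edge this makes only two.
      obtain ⟨y, hy, hyX, hr, hr'⟩ := hX _ hh (.inr (h.1, !h.2)) (.inr h')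
      rcases y with p | ⟨e, b⟩
      · have hy : ends h.1 h.2 = p.1 := hy
        exact hr' (SimpleGraph.Adj.reachable ⟨hh'.trans hy, hX', hyX⟩)
      · have h1 : h.1 = e := hy.1
        have h2 : h.2 ≠ b := hy.2
        have h3 : (!h.2) = b := Bool.not_eq.2 h2
        rw [h1, h3] at hr
        exact hr (SimpleGraph.Reachable.refl _)
  refine ⟨S, T, fun v hv => hv.1, fun v hv => hv.1, ?_, ?_, ?_, ?_⟩
  · rw [Set.disjoint_left]
    exact fun v hS hT => hT.2.1 hS
  · ext (p | h)
    · exact ⟨hcopy p, fun hp => hp.2 p.2⟩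
    · exact ⟨hhalf h, fun hh => hh.2.2 h rfl⟩
  · intro v hv hS
    by_contra h0
    exact hS ⟨hv, fun i => (h0 (i.val.zero_le.trans_lt i.isLt)).elim⟩
  · intro v hv hS hT
    by_contra! hcon
    exact hT ⟨hv, hS, fun h hh => (hcon h.1 h.1.2 h.2 hh).elim⟩

end Barrier

/-! ### Counting odd components of the gadget -/

section OddComponents

variable {G : Graph α β} {ends : β → Bool → α} {S T : Set α}

/-- The vertex set of the component of the gadget that corresponds to a component `Q` of
`G - S - T`. -/
def gadgetComponent (W : Finset α) (F : Finset β) (f : α → ℕ) (ends : β → Bool → α)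
    (S Q : Set α) : Set (GadgetVertex W F f) :=
  gadgetSet W F f Q (fun e b => ends e b ∈ Q ∨ (ends e b ∈ S ∧ ends e (!b) ∈ Q))

/-- An edge inside `Q` or from `Q` to `S` contributes two half-edges, an edge from `Q` to `T` only
one. -/
lemma odd_of_odd_ncard_gadgetComponent (hE : G.IsEnds F ends) (hV : G.vertexSet = W)
    (hST : Disjoint S T) {Q : Set α}
    (hQ : Q ∈ ((G.deleteVerts S).deleteVerts T).componentSets)
    (hodd : Odd (gadgetComponent W F f ends S Q).ncard) :
    Odd (vertexSum f Q + G.numEdgesBetween Q T) := by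
  have hQsub := subset_of_mem_componentSets_deleteVerts hQ
  have hQV : Q ⊆ W := fun v hv => hV ▸ (hQsub hv).1.1
  rw [gadgetComponent, ncard_gadgetSet] at hodd
  rw [vertexSum_eq_sum hQV, hE.numEdgesBetween_eq]
  have heven : Even ((∑ e ∈ F,
      ((if ends e false ∈ Q ∨ (ends e false ∈ S ∧ ends e (!false) ∈ Q) then 1 else 0) +
        (if ends e true ∈ Q ∨ (ends e true ∈ S ∧ ends e (!true) ∈ Q) then 1 else 0))) +
      ∑ e ∈ F, if (ends e false ∈ Q ∧ ends e true ∈ T) ∨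
        (ends e false ∈ T ∧ ends e true ∈ Q) then 1 else 0) := by
    rw [← Finset.sum_add_distrib]
    refine Finset.even_sum _ fun e he => ?_
    have hl := hE.isLink e he
    have ha := @hQsub (ends e false)
    have hb := @hQsub (ends e true)
    have hc1 := mem_of_isLink_of_mem_componentSets_deleteVerts hQ hl
    have hc2 := mem_of_isLink_of_mem_componentSets_deleteVerts hQ hl.symm
    have hd1 : ends e false ∈ S → ends e false ∉ T := fun h h' => Set.disjoint_left.1 hST h h'
    have hd2 : ends e true ∈ S → ends e true ∉ T := fun h h' => Set.disjoint_left.1 hST h h'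
    simp only [Set.mem_sdiff] at ha hb
    clear hV hQsub hQV hodd hl
    by_cases h4 : ends e false ∈ Q <;>
      by_cases h5 : ends e true ∈ Q <;> by_cases h6 : ends e false ∈ T <;>
      by_cases h7 : ends e true ∈ T <;> by_cases h8 : ends e false ∈ S <;>
      by_cases h9 : ends e true ∈ S <;> simp_all
  rw [Nat.odd_iff] at hodd ⊢
  rw [Nat.even_iff] at heven
  omega

/-- The component of the gadget containing a copy of a vertex outside `S ∪ T`. -/
lemma supp_eq_gadgetComponent
    (hE : G.IsEnds F ends) (hV : G.vertexSet = W) (hST : Disjoint S T)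
    (hpos : ∀ v ∈ W, v ∉ S → 0 < f v)
    (hinc : ∀ v ∈ W, v ∉ S → v ∉ T → ∃ e ∈ F, ∃ b, ends e b = v)
    (p : Σ v : W, Fin (f v)) (hpS : (p.1 : α) ∉ S)
    (hpT : (p.1 : α) ∉ T) :
    (((gadget W F f ends).isolate (gadgetSet W F f S
      (fun e b => ends e b ∈ T))).connectedComponentMk (.inl p)).supp =
    gadgetComponent W F f ends S
      {y | Relation.ReflTransGen ((G.deleteVerts S).deleteVerts T).Adj p.1 y} := by
  set Γ := (gadget W F f ends).isolate (gadgetSet W F f S (fun e b => ends e b ∈ T)) with hΓ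
  set Q : Set α := {y | Relation.ReflTransGen ((G.deleteVerts S).deleteVerts T).Adj p.1 y} with hQd
  have hpV : (p.1 : α) ∈ G.vertexSet := hV ▸ p.1.2
  have hQ : Q ∈ ((G.deleteVerts S).deleteVerts T).componentSets :=
    ⟨p.1, by simpa using ⟨⟨hpV, hpS⟩, hpT⟩, rfl⟩
  have hQsub := subset_of_mem_componentSets_deleteVerts hQ
  have hdis : ∀ v ∈ S, v ∉ T := fun v h h' => Set.disjoint_left.1 hST h h'
  have hopp : ∀ h : F × Bool, ends h.1 h.2 ∉ T → ends h.1 (!h.2) ∉ T →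
      Γ.Adj (.inr h) (.inr (h.1, !h.2)) := fun h h1 h2 =>
    ⟨⟨rfl, by simp⟩, h1, h2⟩
  have hcopy : ∀ (h : F × Bool) (p : Σ v : W, Fin (f v)), ends h.1 h.2 = p.1 →
      (p.1 : α) ∉ S → (p.1 : α) ∉ T → Γ.Adj (.inr h) (.inl p) := by
    intro h p h1 h2 h3
    refine ⟨h1, ?_, h2⟩
    rw [inr_mem_gadgetSet, h1]
    exact h3
  have hreach : ∀ y, Relation.ReflTransGen ((G.deleteVerts S).deleteVerts T).Adj p.1 y →
      ∀ p' : Σ v : W, Fin (f v), (p'.1 : α) = y → Γ.Reachable (.inl p) (.inl p') := by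
    intro y hy
    induction hy with
    | refl =>
      intro p' hp'
      -- Copies are never adjacent to each other; two copies of one vertex are linked through a
      -- half-edge at it.
      obtain ⟨e, he, b, hb⟩ := hinc p.1 p.1.2 hpS hpT
      exact (hcopy (⟨e, he⟩, b) p hb hpS hpT).symm.reachable.trans
        (hcopy (⟨e, he⟩, b) p' (hb.trans hp'.symm) (hp' ▸ hpS) (hp' ▸ hpT)).reachable
    | @tail y z hy hyz ih =>
      intro p' hp'
      obtain ⟨e, he⟩ := hyz
      simp only [deleteVerts_isLink, hE.isLink_iff] at he
      obtain ⟨⟨⟨heF, hends⟩, hyS, hzS⟩, hyT, hzT⟩ := he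
      obtain ⟨b, hb1, hb2⟩ : ∃ b, ends e b = y ∧ ends e (!b) = z := by
        rcases hends with h | h
        · exact ⟨false, h.1, h.2⟩
        · exact ⟨true, h.2, h.1⟩
      have hyW : y ∈ W := by
        have : y ∈ (W : Set α) := hV ▸ hb1 ▸ hE.ends_mem heF b
        exact this
      let py : Σ v : W, Fin (f v) := ⟨⟨y, hyW⟩, ⟨0, hpos y hyW hyS⟩⟩
      have h1 := ih py rfl
      have h2 := (hcopy (⟨e, heF⟩, b) py hb1 hyS hyT).symm.reachable
      have h3 := (hopp (⟨e, heF⟩, b) (by rwa [hb1]) (by rwa [hb2])).reachable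
      have h4 := (hcopy (⟨e, heF⟩, !b) p' (hb2.trans hp'.symm) (hp' ▸ hzS) (hp' ▸ hzT)).reachable
      exact ((h1.trans h2).trans h3).trans h4
  have hhalf : ∀ h : F × Bool, ends h.1 h.2 ∈ Q → Γ.Reachable (.inl p) (.inr h) := by
    intro h hh
    have hs := hQsub hh
    have hyW : ends h.1 h.2 ∈ W := by
      have : ends h.1 h.2 ∈ (W : Set α) := hV ▸ hs.1.1
      exact this
    let py : Σ v : W, Fin (f v) := ⟨⟨_, hyW⟩, ⟨0, hpos _ hyW hs.1.2⟩⟩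
    exact (hreach _ hh py rfl).trans (hcopy h py rfl hs.1.2 hs.2).symm.reachable
  ext z
  simp only [SimpleGraph.ConnectedComponent.mem_supp_iff, SimpleGraph.ConnectedComponent.eq]
  constructor
  · intro hz
    refine hz.symm.mem_of_forall_adj ?_ (show (p.1 : α) ∈ Q from .refl)
    rintro (q | h) hx (q' | h') hadj
    · exact hadj.1.elim
    · have h1 : ends h'.1 h'.2 = q.1 := hadj.1
      refine Or.inl ?_
      rw [h1]
      exact hx
    · have h1 : ends h.1 h.2 = q'.1 := hadj.1
      have h2 : (q'.1 : α) ∉ S := hadj.2.2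
      change (q'.1 : α) ∈ Q
      rcases hx with hx | hx
      · rwa [← h1]
      · exact (h2 (h1 ▸ hx.1)).elim
    · have h1 : h.1 = h'.1 := hadj.1.1
      have h2 : h.2 ≠ h'.2 := hadj.1.2
      have h3 : h.2 = !h'.2 := Bool.eq_not.2 h2
      have h4 : ends h.1 h.2 ∉ T := hadj.2.1
      have h5 : ends h'.1 h'.2 ∉ T := hadj.2.2
      change ends h.1 h.2 ∈ Q ∨ (ends h.1 h.2 ∈ S ∧ ends h.1 (!h.2) ∈ Q) at hx
      change ends h'.1 h'.2 ∈ Q ∨ (ends h'.1 h'.2 ∈ S ∧ ends h'.1 (!h'.2) ∈ Q)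
      rw [h1, h3] at hx
      rw [Bool.not_not] at hx
      rcases hx with hx | hx
      · by_cases h6 : ends h'.1 h'.2 ∈ S
        · exact .inr ⟨h6, hx⟩
        · exact .inl (mem_of_isLink_of_mem_componentSets_deleteVerts hQ
            (hE.isLink_not h'.1.2 h'.2).symm hx h6 h5)
      · exact .inl hx.2
  · intro hz
    symm
    rcases z with q | h
    · exact hreach _ hz q rfl
    · rcases hz with hz | hz
      · exact hhalf h hz
      · have h1 := hhalf (h.1, !h.2) hz.2
        have h2 := hopp h (hdis _ hz.1) (hQsub hz.2).2
        exact h1.trans h2.symm.reachable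

/-- The four terms count isolated barrier vertices, copies of `T` (all their neighbours lie in the
barrier), half-edges at `S` with opposite end in `T`, and components from odd `Q`. -/
lemma ncard_oddComponents_gadget_le
    (hE : G.IsEnds F ends) (hV : G.vertexSet = W) (hST : Disjoint S T)
    (hpos : ∀ v ∈ W, v ∉ S → 0 < f v)
    (hinc : ∀ v ∈ W, v ∉ S → v ∉ T → ∃ e ∈ F, ∃ b, ends e b = v) :
    ((gadget W F f ends).isolate (gadgetSet W F f S
      (fun e b => ends e b ∈ T))).oddComponents.ncard ≤
    (gadgetSet W F f S (fun e b => ends e b ∈ T)).ncard +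
      ((gadgetSet W F f T (fun _ _ => False)).ncard +
      ((gadgetSet W F f ∅ (fun e b => ends e b ∈ S ∧ ends e (!b) ∈ T)).ncard +
      G.numBad f S T)) := by
  set X := gadgetSet W F f S (fun e b => ends e b ∈ T) with hX
  set Γ := (gadget W F f ends).isolate X with hΓ
  have hdis : ∀ v ∈ S, v ∉ T := fun v h h' => Set.disjoint_left.1 hST h h'
  have hfin : {Q | Q ∈ ((G.deleteVerts S).deleteVerts T).componentSets ∧
      Odd (vertexSum f Q + G.numEdgesBetween Q T)}.Finite :=
    (finite_componentSets_deleteVerts (hV ▸ W.finite_toSet)).subset (Set.sep_subset _ _)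
  rw [← Set.ncard_image_of_injective _ SimpleGraph.ConnectedComponent.supp_injective]
  have hsub : SimpleGraph.ConnectedComponent.supp '' Γ.oddComponents ⊆
      (fun z => {z}) '' X ∪ ((fun z => {z}) '' gadgetSet W F f T (fun _ _ => False) ∪
      ((fun z => {z}) '' gadgetSet W F f ∅ (fun e b => ends e b ∈ S ∧ ends e (!b) ∈ T) ∪
      gadgetComponent W F f ends S '' {Q | Q ∈ ((G.deleteVerts S).deleteVerts T).componentSets ∧
        Odd (vertexSum f Q + G.numEdgesBetween Q T)})) := by
    rintro _ ⟨c, hc, rfl⟩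
    have hmain : ∀ p : Σ v : W, Fin (f v), (p.1 : α) ∉ S → (p.1 : α) ∉ T →
        c = Γ.connectedComponentMk (.inl p) → c.supp ∈ gadgetComponent W F f ends S ''
          {Q | Q ∈ ((G.deleteVerts S).deleteVerts T).componentSets ∧
            Odd (vertexSum f Q + G.numEdgesBetween Q T)} := by
      rintro p hpS hpT rfl
      have hs := supp_eq_gadgetComponent hE hV hST hpos hinc p hpS hpT
      have hpV : (p.1 : α) ∈ G.vertexSet := hV ▸ p.1.2
      have hQ : {y | Relation.ReflTransGen ((G.deleteVerts S).deleteVerts T).Adj p.1 y} ∈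
          ((G.deleteVerts S).deleteVerts T).componentSets :=
        ⟨p.1, by simpa using ⟨⟨hpV, hpS⟩, hpT⟩, rfl⟩
      refine ⟨_, ⟨hQ, odd_of_odd_ncard_gadgetComponent (f := f) hE hV hST hQ ?_⟩, hs.symm⟩
      rw [← hs]
      exact hc
    have hend : ∀ h : F × Bool, ends h.1 h.2 ∉ S → ends h.1 h.2 ∉ T →
        c = Γ.connectedComponentMk (.inr h) → c.supp ∈ gadgetComponent W F f ends S ''
          {Q | Q ∈ ((G.deleteVerts S).deleteVerts T).componentSets ∧
            Odd (vertexSum f Q + G.numEdgesBetween Q T)} := by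
      intro h hS hT hc
      have hyW : ends h.1 h.2 ∈ W := by
        have : ends h.1 h.2 ∈ (W : Set α) := hV ▸ hE.ends_mem h.1.2 h.2
        exact this
      refine hmain ⟨⟨_, hyW⟩, ⟨0, hpos _ hyW hS⟩⟩ hS hT (hc.trans ?_)
      rw [SimpleGraph.ConnectedComponent.eq]
      exact SimpleGraph.Adj.reachable ⟨rfl, hT, hS⟩
    induction c using SimpleGraph.ConnectedComponent.ind with | _ z
    by_cases hzX : z ∈ X
    · refine .inl ⟨z, hzX, ?_⟩
      exact (SimpleGraph.supp_eq_singleton_of_forall_not_adj (G := Γ)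
        fun y hy => hy.2.1 hzX).symm
    rcases z with p | h
    · by_cases hpT : (p.1 : α) ∈ T
      · refine .inr (.inl ⟨.inl p, hpT, ?_⟩)
        refine (SimpleGraph.supp_eq_singleton_of_forall_not_adj (G := Γ) fun y hy => ?_).symm
        rcases y with q | h
        · exact hy.1
        · have h1 : ends h.1 h.2 = p.1 := hy.1
          have h2 : ends h.1 h.2 ∉ T := hy.2.2
          exact h2 (h1 ▸ hpT)
      · exact .inr (.inr (.inr (hmain p hzX hpT rfl)))
    · have hhT : ends h.1 h.2 ∉ T := hzX
      by_cases hhS : ends h.1 h.2 ∈ S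
      · have hnocopy : ∀ q, ¬ Γ.Adj (.inr h) (.inl q) := fun q hq => by
          have h1 : ends h.1 h.2 = q.1 := hq.1
          have h2 : (q.1 : α) ∉ S := hq.2.2
          exact h2 (h1 ▸ hhS)
        have hflip : ∀ h' : F × Bool, Γ.Adj (.inr h) (.inr h') → h' = (h.1, !h.2) := by
          intro h' hh'
          have h1 : h.1 = h'.1 := hh'.1.1
          have h2 : h.2 ≠ h'.2 := hh'.1.2
          exact Prod.ext h1.symm (Bool.not_eq.2 h2).symm
        by_cases hoT : ends h.1 (!h.2) ∈ T
        · refine .inr (.inr (.inl ⟨.inr h, ⟨hhS, hoT⟩, ?_⟩))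
          refine (SimpleGraph.supp_eq_singleton_of_forall_not_adj (G := Γ) fun y hy => ?_).symm
          rcases y with q | h'
          · exact hnocopy q hy
          · have h2 : ends h'.1 h'.2 ∉ T := hy.2.2
            rw [hflip h' hy] at h2
            exact h2 hoT
        · have hadj : Γ.Adj (.inr h) (.inr (h.1, !h.2)) := ⟨⟨rfl, by simp⟩, hhT, hoT⟩
          have hcc : Γ.connectedComponentMk (.inr h) =
              Γ.connectedComponentMk (.inr (h.1, !h.2)) :=
            SimpleGraph.ConnectedComponent.eq.2 hadj.reachable
          by_cases hoS : ends h.1 (!h.2) ∈ S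
          -- An edge with both ends in `S` leaves a component of two half-edges, which is even.
          · exfalso
            have hsupp : (Γ.connectedComponentMk (.inr h)).supp =
                {.inr h, .inr (h.1, !h.2)} := by
              ext y
              simp only [SimpleGraph.ConnectedComponent.mem_supp_iff,
                SimpleGraph.ConnectedComponent.eq]
              constructor
              · intro hy
                refine hy.symm.mem_of_forall_adj ?_ (.inl rfl)
                rintro _ (rfl | rfl) (q | h') hadj'
                · exact (hnocopy q hadj').elim
                · rw [hflip h' hadj']
                  exact .inr rfl
                · have h1 : ends h.1 (!h.2) = q.1 := hadj'.1
                  have h2 : (q.1 : α) ∉ S := hadj'.2.2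
                  exact (h2 (h1 ▸ hoS)).elim
                · have h1 : h.1 = h'.1 := hadj'.1.1
                  have h2 : (!h.2) ≠ h'.2 := hadj'.1.2
                  have h3 : h.2 = h'.2 := by simpa using h2
                  exact .inl (congrArg Sum.inr (Prod.ext h1.symm h3.symm))
              · rintro (rfl | rfl)
                · rfl
                · exact hadj.symm.reachable
            have hodd : Odd (Γ.connectedComponentMk (.inr h)).supp.ncard := hc
            rw [hsupp, Set.ncard_pair hadj.ne] at hodd
            exact absurd hodd (by decide)
          · exact .inr (.inr (.inr (hend (h.1, !h.2) hoS hoT hcc)))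
      · exact .inr (.inr (.inr (hend h hhS hhT rfl)))
  have hB := hfin.image (gadgetComponent W F f ends S)
  refine (Set.ncard_le_ncard hsub (Set.toFinite _)).trans ?_
  refine (Set.ncard_union_le _ _).trans (add_le_add (Set.ncard_image_le (Set.toFinite _)) ?_)
  refine (Set.ncard_union_le _ _).trans (add_le_add (Set.ncard_image_le (Set.toFinite _)) ?_)
  refine (Set.ncard_union_le _ _).trans (add_le_add (Set.ncard_image_le (Set.toFinite _)) ?_)
  exact Set.ncard_image_le hfin

end OddComponents

/-! ### From matchings of the gadget to bounded subgraphs -/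

section Matching

variable {W : Finset α} {F : Finset β} {f : α → ℕ} {ends : β → Bool → α} {d : ℕ}

/-- The edges both of whose half-edges are matched to copies of vertices. -/
def matchedEdges (m : GadgetVertex W F f → GadgetVertex W F f ⊕ Fin d) : Set β :=
  {e | ∃ he : e ∈ F, ∀ b, ∃ p, m (.inr (⟨e, he⟩, b)) = .inl (.inl p)}

variable {m : GadgetVertex W F f → GadgetVertex W F f ⊕ Fin d}

/-- The matching injects the half-edges at v of matched edges into the f(v) copies of v; a loop uses
two of them, as in the degree. -/
lemma sum_matchedEdges_le
    (hinj : Function.Injective m)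
    (hm : ∀ x y, m x = .inl y → (gadget W F f ends).Adj x y ∧ m y = .inl x)
    {v : α} (hv : v ∈ W) :
    (∑ e ∈ F, if e ∈ matchedEdges m then ((if ends e false = v then 1 else 0) +
      (if ends e true = v then 1 else 0)) else 0) ≤ f v := by
  have h1 := ncard_gadgetSet (W := W) (F := F) (f := f) ∅
    (fun e b => e ∈ matchedEdges m ∧ ends e b = v)
  have h2 := ncard_gadgetSet (W := W) (F := F) (f := f) {v} (fun _ _ => False)
  have h3 : (gadgetSet W F f ∅ (fun e b => e ∈ matchedEdges m ∧ ends e b = v)).ncard ≤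
      (gadgetSet W F f {v} (fun _ _ => False)).ncard := by
    have hmatch : ∀ z ∈ gadgetSet W F f ∅ (fun e b => e ∈ matchedEdges m ∧ ends e b = v),
        ∃ y ∈ gadgetSet W F f {v} (fun _ _ => False), m z = .inl y := by
      rintro (p | ⟨e, b⟩) hz
      · exact hz.elim
      · obtain ⟨⟨he, hp⟩, hev⟩ := hz
        obtain ⟨p, hp⟩ := hp b
        have h4 : ends e b = p.1 := (hm _ _ hp).1
        exact ⟨.inl p, h4.symm.trans hev, hp⟩
    choose! g hg hg' using hmatch
    refine Set.ncard_le_ncard_of_injOn g hg (fun x hx y hy hxy => hinj ?_) (Set.toFinite _)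
    rw [hg' x hx, hg' y hy, hxy]
  have h4 : (∑ w ∈ W, if w ∈ ({v} : Set α) then f w else 0) = f v := by
    simp [hv]
  simp only [Set.mem_singleton_iff, if_false, add_zero, Finset.sum_const_zero] at h2 h4
  rw [h2, h4, h1] at h3
  refine le_trans ?_ h3
  refine le_trans (Finset.sum_le_sum fun e _ => ?_) (Nat.le_add_left _ _)
  by_cases he : e ∈ matchedEdges m <;> simp [he]

lemma sum_le_two_mul_card_matchedEdges_add
    (hinj : Function.Injective m)
    (hm : ∀ x y, m x = .inl y → (gadget W F f ends).Adj x y ∧ m y = .inl x) :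
    ∑ v ∈ W, f v ≤ 2 * (F.filter (· ∈ matchedEdges m)).card + d := by
  let C : Set (GadgetVertex W F f) := gadgetSet W F f Set.univ (fun _ _ => False)
  let A : Set (GadgetVertex W F f) :=
    {z ∈ C | ∃ y ∈ gadgetSet W F f ∅ (fun e _ => e ∈ matchedEdges m), m z = .inl y}
  have hC : C.ncard = ∑ v ∈ W, f v := by
    simp [C, ncard_gadgetSet]
  have hA : A.ncard ≤ 2 * (F.filter (· ∈ matchedEdges m)).card := by
    have h1 := ncard_gadgetSet (W := W) (F := F) (f := f) ∅ (fun e _ => e ∈ matchedEdges m)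
    have h2 : A.ncard ≤ (gadgetSet W F f ∅ (fun e _ => e ∈ matchedEdges m)).ncard := by
      have hmatch : ∀ z ∈ A, ∃ y ∈ gadgetSet W F f ∅ (fun e _ => e ∈ matchedEdges m),
          m z = .inl y := fun z hz => hz.2
      choose! g hg hg' using hmatch
      refine Set.ncard_le_ncard_of_injOn g hg (fun x hx y hy hxy => hinj ?_) (Set.toFinite _)
      rw [hg' x hx, hg' y hy, hxy]
    refine h2.trans (h1.trans ?_).le
    simp only [Set.mem_empty_iff_false, if_false, Finset.sum_const_zero, zero_add,
      Finset.card_filter, Finset.mul_sum]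
    exact Finset.sum_congr rfl fun e _ => by split_ifs <;> rfl
  have hB : (C \ A).ncard ≤ d := by
    -- If a copy is matched to a half-edge of an unmatched edge, the opposite half-edge has neither
    -- a copy nor its twin as partner, so it uses one of the d extra points. The copy is charged to
    -- that point.
    have hmatch : ∀ z ∈ C \ A, ∃ i : Fin d, m z = .inr i ∨
        ∃ e b, m z = .inl (.inr (e, b)) ∧ m (.inr (e, !b)) = .inr i := by
      rintro (p | h) ⟨hzC, hzA⟩
      · rcases hz : m (.inl p) with (q | ⟨e, b⟩) | i
        · exact (hm _ _ hz).1.elim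
        · have hzb := (hm _ _ hz).2
          rcases ho : m (.inr (e, !b)) with (q | ⟨e', b'⟩) | i
          · refine (hzA ⟨hzC, .inr (e, b), ⟨e.2, fun b' => ?_⟩, hz⟩).elim
            by_cases hb : b' = b
            · subst hb
              exact ⟨p, hzb⟩
            · rw [Bool.eq_not.2 hb]
              exact ⟨q, ho⟩
          · exfalso
            have h1 : e = e' := (hm _ _ ho).1.1
            have h2 : (!b) ≠ b' := (hm _ _ ho).1.2
            have h3 : b = b' := by simpa using h2
            have h4 := (hm _ _ ho).2
            rw [← h1, ← h3, hzb] at h4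
            cases h4
          · exact ⟨i, .inr ⟨e, b, rfl, ho⟩⟩
        · exact ⟨i, .inl rfl⟩
      · exact hzC.elim
    have hcopy : ∀ z ∈ C, ∀ w, z ≠ .inr w := by
      rintro (p | h) hz w
      · simp
      · exact hz.elim
    by_cases hne : (C \ A).Nonempty
    · obtain ⟨z₀, hz₀⟩ := hne
      have : Nonempty (Fin d) := ⟨(hmatch z₀ hz₀).choose⟩
      choose! g hg using hmatch
      refine (Set.ncard_le_ncard_of_injOn (t := Set.univ) g (fun _ _ => trivial)
        (fun x hx y hy hxy => ?_) (Set.toFinite _)).trans (by simp [Set.ncard_univ])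
      have h1 := hg x hx
      have h2 := hg y hy
      rw [← hxy] at h2
      rcases h1 with h1 | ⟨e, b, h1, h1'⟩ <;> rcases h2 with h2 | ⟨e', b', h2, h2'⟩
      · exact hinj (h1.trans h2.symm)
      · exact (hcopy x hx.1 _ (hinj (h1.trans h2'.symm))).elim
      · exact (hcopy y hy.1 _ (hinj (h2.trans h1'.symm))).elim
      · have h3 := hinj (h1'.trans h2'.symm)
        simp only [Sum.inr.injEq, Prod.mk.injEq] at h3
        have h4 : b = b' := by simpa using h3.2
        refine hinj (h1.trans ?_)
        rw [h2, h3.1, h4]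
    · rw [Set.not_nonempty_iff_eq_empty.1 hne]
      simp
  have h1 : C.ncard ≤ A.ncard + (C \ A).ncard := by
    have : C ⊆ A ∪ (C \ A) := fun z hz => by
      by_cases h : z ∈ A
      exacts [.inl h, .inr ⟨hz, h⟩]
    exact (Set.ncard_le_ncard this (Set.toFinite _)).trans (Set.ncard_union_le _ _)
  omega

end Matching

/-! ### The min-max formula -/

/-- Some `f`-bounded subgraph attains the bound given by some pair of disjoint vertex sets. -/
lemma exists_isBoundedSubgraph_le_deficiency {G : Graph α β} (hV : G.vertexSet.Finite)
    {F : Finset β} {ends : β → Bool → α} (hE : G.IsEnds F ends) (f : α → ℕ) :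
    ∃ (H : Graph α β) (S T : Set α), H.IsBoundedSubgraph G f ∧ S ⊆ G.vertexSet ∧
      T ⊆ G.vertexSet ∧ Disjoint S T ∧
      (vertexSum f G.vertexSet : ℤ) - vertexSum H.degree H.vertexSet ≤ G.deficiency f S T := by
  obtain ⟨W, hW⟩ := hV.exists_finset_coe
  have hW : G.vertexSet = W := hW.symm
  obtain ⟨X, d, hXd, hX, m, hinj, hm⟩ := (gadget W F f ends).exists_barrier_and_matching
  have hends : ∀ e ∈ F, ∀ b, ends e b ∈ W := fun e he b => by
    have : ends e b ∈ (W : Set α) := hW ▸ hE.ends_mem he b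
    exact this
  obtain ⟨S, T, hS, hT, hST, rfl, hpos, hinc⟩ := exists_eq_gadgetSet_of_barrier hends hX
  have hle : G.restrict (matchedEdges m) ≤ G := restrict_le
  have hHE := hE.of_le hle
  have hFH : F.filter (· ∈ (G.restrict (matchedEdges m)).edgeSet) =
      F.filter (· ∈ matchedEdges m) := by
    refine Finset.filter_congr fun e he => ?_
    simp [hE.edgeSet_eq, he]
  rw [hFH] at hHE
  refine ⟨G.restrict (matchedEdges m), S, T, ⟨⟨hle, rfl⟩, fun v hv => ?_⟩, hW ▸ hS, hW ▸ hT, hST,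
    ?_⟩
  · rw [hHE.degree_eq, Finset.sum_filter]
    exact sum_matchedEdges_le hinj hm (by simpa [hW] using hv)
  · have h1 := sum_le_two_mul_card_matchedEdges_add hinj hm
    have h2 := ncard_oddComponents_gadget_le (f := f) hE hW hST hpos hinc
    rw [hXd, ncard_gadgetSet, ncard_gadgetSet, ncard_gadgetSet] at h2
    have h3 : vertexSum f G.vertexSet = ∑ v ∈ W, f v := by
      rw [vertexSum_eq_sum hW.subset]
      exact Finset.sum_congr rfl fun v hv => if_pos (by simpa [hW] using hv)
    -- This is ‖S,T‖ + d_{G-S}(T) = d_G(T), which turns the bound on d into def(S,T).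
    have h4 : (∑ e ∈ F, ((if ends e false ∈ S ∧ ends e (!false) ∈ T then 1 else 0) +
        (if ends e true ∈ S ∧ ends e (!true) ∈ T then 1 else 0))) +
        vertexSum (G.deleteVerts S).degree T =
        ∑ e ∈ F, ((if ends e false ∈ T then 1 else 0) + (if ends e true ∈ T then 1 else 0)) := by
      rw [(hE.deleteVerts S).vertexSum_degree (W.finite_toSet.subset hT), Finset.sum_filter,
        ← Finset.sum_add_distrib]
      refine Finset.sum_congr rfl fun e _ => ?_
      have ha : ends e false ∈ S → ends e false ∉ T := fun h => Set.disjoint_left.1 hST h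
      have hb : ends e true ∈ S → ends e true ∉ T := fun h => Set.disjoint_left.1 hST h
      by_cases h4 : ends e false ∈ S <;>
        by_cases h5 : ends e true ∈ S <;> by_cases h6 : ends e false ∈ T <;>
        by_cases h7 : ends e true ∈ T <;>
        first
          | exact absurd h6 (ha h4)
          | exact absurd h7 (hb h5)
          | simp [h4, h5, h6, h7]
    have h5 := hHE.vertexSum_degree_vertexSet (show (G.restrict _).vertexSet.Finite from hV)
    rw [deficiency, h3, h5, vertexSum_eq_sum hS, vertexSum_eq_sum hT]
    simp only [if_false, add_zero, Finset.sum_const_zero, Set.mem_empty_iff_false, zero_add] at h2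
    omega

lemma vertexSum_of_isEmpty [IsEmpty α] (g : α → ℕ) (A : Set α) : vertexSum g A = 0 := by
  rw [Set.eq_empty_of_isEmpty A]
  simp [vertexSum]

lemma deficiency_of_isEmpty [IsEmpty α] (G : Graph α β) (f : α → ℕ) (S T : Set α) :
    G.deficiency f S T = 0 := by
  simp [deficiency, vertexSum_of_isEmpty, numBad, componentSets]

/-- The min-max formula for bounded subgraphs, together with the handshake identity. -/
lemma exists_isBoundedSubgraph_eq_deficiency (G : Graph α β) (hV : G.vertexSet.Finite)
    (hE : G.edgeSet.Finite) (f : α → ℕ) :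
    (∀ H : Graph α β, H.IsBoundedSubgraph G f →
      vertexSum H.degree H.vertexSet = 2 * H.edgeSet.ncard ∧
      ∀ S T, S ⊆ G.vertexSet → T ⊆ G.vertexSet → Disjoint S T →
        G.deficiency f S T ≤ (vertexSum f G.vertexSet : ℤ) - vertexSum H.degree H.vertexSet) ∧
    ∃ (H : Graph α β) (S T : Set α), H.IsBoundedSubgraph G f ∧ S ⊆ G.vertexSet ∧
      T ⊆ G.vertexSet ∧ Disjoint S T ∧
      G.deficiency f S T = (vertexSum f G.vertexSet : ℤ) - vertexSum H.degree H.vertexSet := by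
  -- Choosing ends for labels that are not edges needs a default vertex.
  rcases isEmpty_or_nonempty α with hα | hα
  · have hempty : ∀ H : Graph α β, H.edgeSet = ∅ := fun H => by
      refine Set.eq_empty_of_forall_notMem fun e he => ?_
      obtain ⟨x, -⟩ := H.exists_isLink_of_mem_edgeSet he
      exact isEmptyElim x
    refine ⟨fun H _ => ?_, G, ∅, ∅, ⟨IsSpanningSubgraph.rfl, fun v => isEmptyElim v⟩, ?_⟩
    · simp [vertexSum_of_isEmpty, deficiency_of_isEmpty, hempty]
    · simp [vertexSum_of_isEmpty, deficiency_of_isEmpty]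
  · obtain ⟨F, ends, hends⟩ := G.exists_isEnds hE
    have hVH : ∀ H : Graph α β, H.IsBoundedSubgraph G f → H.vertexSet = G.vertexSet :=
      fun H hH => hH.1.vertexSet_eq
    refine ⟨fun H hH => ⟨?_, fun S T hS hT hST => ?_⟩, ?_⟩
    · have h := hends.of_le hH.1.le
      rw [h.vertexSum_degree_vertexSet (hVH H hH ▸ hV), ← Set.ncard_coe_finset, ← h.edgeSet_eq]
    · rw [hVH H hH]
      exact hH.deficiency_le hends hV hS hT hST
    · obtain ⟨H, S, T, hH, hS, hT, hST, h⟩ := exists_isBoundedSubgraph_le_deficiency hV hends f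
      refine ⟨H, S, T, hH, hS, hT, hST, le_antisymm ?_ h⟩
      rw [hVH H hH]
      exact hH.deficiency_le hends hV hS hT hST

end Graph

theorem theorem3p1 {α β : Type*} (G : Graph α β) (hV : G.vertexSet.Finite)
    (hE : G.edgeSet.Finite) (f : α → ℕ) :
    (∃ h : ℕ,
      IsGreatest {d : ℕ | ∃ H : Graph α β, H.IsBoundedSubgraph G f ∧
        d = Graph.vertexSum H.degree H.vertexSet} h ∧
      IsLeast {z : ℤ | ∃ S T : Set α, S ⊆ G.vertexSet ∧ T ⊆ G.vertexSet ∧ Disjoint S T ∧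
        z = (Graph.vertexSum f G.vertexSet : ℤ) - G.deficiency f S T} (h : ℤ)) ∧
    (∃ (m : ℕ) (γ : ℤ),
      IsGreatest {k : ℕ | ∃ H : Graph α β, H.IsBoundedSubgraph G f ∧ k = H.edgeSet.ncard} m ∧
      IsGreatest {z : ℤ | ∃ S T : Set α, S ⊆ G.vertexSet ∧ T ⊆ G.vertexSet ∧ Disjoint S T ∧
        z = G.deficiency f S T} γ ∧
      (m : ℚ) = 1 / 2 * ((Graph.vertexSum f G.vertexSet : ℚ) - (γ : ℚ))) := by
  obtain ⟨hle, H, S, T, hH, hS, hT, hST, heq⟩ :=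
    G.exists_isBoundedSubgraph_eq_deficiency hV hE f
  refine ⟨⟨Graph.vertexSum H.degree H.vertexSet, ⟨⟨H, hH, rfl⟩, ?_⟩, ⟨S, T, hS, hT, hST, ?_⟩, ?_⟩,
    H.edgeSet.ncard, G.deficiency f S T, ⟨⟨H, hH, rfl⟩, ?_⟩, ⟨⟨S, T, hS, hT, hST, rfl⟩, ?_⟩, ?_⟩
  · rintro _ ⟨H', hH', rfl⟩
    have := (hle H' hH').2 S T hS hT hST
    omega
  · omega
  · rintro _ ⟨S', T', hS', hT', hST', rfl⟩
    have := (hle H hH).2 S' T' hS' hT' hST'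
    omega
  · rintro _ ⟨H', hH', rfl⟩
    have h1 := (hle H' hH').2 S T hS hT hST
    have h2 := (hle H' hH').1
    have h3 := (hle H hH).1
    omega
  · rintro _ ⟨S', T', hS', hT', hST', rfl⟩
    have := (hle H hH).2 S' T' hS' hT' hST'
    omega
  · have h1 := (hle H hH).1
    rw [heq, h1]
    push_cast
    ring
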